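/- Rational functions are elements of $\mathbb{C}(z)$; the degree of $A=P/Q$ (in lowest terms) is $\max(\deg P,\deg Q)$, and $A^{\circ k}$ denotes the $k$-th iterate of $A$. For a rational function $F$ let $\Sigma(F)$ be the set of Möbius transformations $\sigma$ with $F\circ\sigma=F$, and put $\Sigma_\infty(A)=\bigcup_{k\ge 1}\Sigma(A^{\circ k})$. A rational function $\widetilde A$ is an elementary transformation of a nonconstant rational function $A$ if there exist rational functions $U,V$ with $A=U\circ V$ and $\widetilde A=V\circ U$; write $A\sim A'$ if there is a finite chain of elementary transformations between $A$ and $A'$. Theorem. Let $A$ be a rational function of degree $n\ge 2$. Then for every $\sigma\in\Sigma_\infty(A)$ the relation $A\circ\sigma\sim A$ holds. -/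

import Mathlib

namespace RationalFunction

/-- The degree of a rational function `P / Q` in lowest terms: `max (deg P) (deg Q)`. -/
noncomputable def degree (f : RatFunc ℂ) : ℕ :=
  max f.num.natDegree f.denom.natDegree

/-- The composition `f ∘ g`: the value of `f` at the element `g` of the field `ℂ(z)`.
For nonconstant `g` the denominator of `f` does not vanish at `g`, so this is the usual
composition; only compositions with a nonconstant inner function are used below. -/
noncomputable def comp (f g : RatFunc ℂ) : RatFunc ℂ :=
  RatFunc.eval RatFunc.C g f

/-- The iterates `f^{∘0} = z`, `f^{∘(k+1)} = f ∘ f^{∘k}`. -/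
noncomputable def iter (f : RatFunc ℂ) : ℕ → RatFunc ℂ
  | 0 => RatFunc.X
  | k + 1 => comp f (iter f k)

/-- Möbius transformations `(a z + b) / (c z + d)` with `a d - b c ≠ 0`. -/
def IsMobius (σ : RatFunc ℂ) : Prop :=
  ∃ a b c d : ℂ, a * d - b * c ≠ 0 ∧
    σ = (RatFunc.C a * RatFunc.X + RatFunc.C b) / (RatFunc.C c * RatFunc.X + RatFunc.C d)

/-- `Σ(A)`: the Möbius transformations `σ` with `A ∘ σ = A`. -/
def Sigma (A : RatFunc ℂ) : Set (RatFunc ℂ) :=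
  {σ | IsMobius σ ∧ comp A σ = A}

/-- `Σ_∞(A)`: the union of `Σ(A^{∘k})` over `k ≥ 1`. -/
def SigmaInfty (A : RatFunc ℂ) : Set (RatFunc ℂ) :=
  ⋃ k ≥ 1, Sigma (iter A k)

/-- `B` is an elementary transformation of `A`: `A = U ∘ V` and `B = V ∘ U` for some
rational functions `U`, `V`. These are taken nonconstant, as they must be if `A` is nonconstant. -/
def IsElementaryTransformation (A B : RatFunc ℂ) : Prop :=
  ∃ U V : RatFunc ℂ, 1 ≤ degree U ∧ 1 ≤ degree V ∧ A = comp U V ∧ B = comp V U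

/-- `A ∼ B`: there is a (finite, possibly empty) chain of elementary transformations
from `A` to `B`. -/
def Equivalent (A B : RatFunc ℂ) : Prop :=
  Relation.ReflTransGen IsElementaryTransformation A B

end RationalFunction

namespace RationalFunction

open IntermediateField

/-! If `A^{∘k} ∘ σ = A^{∘k}`, then `X = A^{∘k}` satisfies `A ∘ X = X ∘ B` with `B = A ∘ σ`. Descend
on `deg X`, keeping `X` a left factor of an iterate of `A` (`equivalent_of_semiconj`). If `ℂ(X, B) ≠
ℂ(z)`, Lüroth's theorem gives a common right factor `V` of `X` and `B`; cancelling it lowers `deg X`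
and changes `B` by an elementary transformation. If `ℂ(X, B) = ℂ(z)`, then
`degree_eq_one_of_adjoin_eq_top`, applied to iterates of `A` and `B`, makes `X` Möbius, so `B` is
conjugate to `A`. -/

/-- Substitution of a nonconstant `g`, as an endomorphism of the field `ℂ(z)`. -/
noncomputable def subst (g : RatFunc ℂ) (hg : ¬∃ c, g = RatFunc.C c) :
    RatFunc ℂ →ₐ[ℂ] RatFunc ℂ :=
  ℂ⟮g⟯.val.comp (RatFunc.algEquivOfTranscendental g (g.transcendental_of_ne_C hg)).toAlgHom

lemma algHom_apply (φ : RatFunc ℂ →ₐ[ℂ] RatFunc ℂ) (f : RatFunc ℂ) :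
    φ f = comp f (φ RatFunc.X) := by
  have key : ∀ p : Polynomial ℂ, φ (algebraMap (Polynomial ℂ) (RatFunc ℂ) p) =
      p.eval₂ RatFunc.C (φ RatFunc.X) := by
    intro p
    rw [← RatFunc.aeval_X_left_eq_algebraMap, ← Polynomial.aeval_algHom_apply]
    rfl
  conv_lhs => rw [← RatFunc.num_div_denom f]
  rw [map_div₀, key, key]
  rfl

lemma subst_X (g : RatFunc ℂ) (hg : ¬∃ c, g = RatFunc.C c) : subst g hg RatFunc.X = g := by
  simp [subst]

lemma subst_apply (f g : RatFunc ℂ) (hg : ¬∃ c, g = RatFunc.C c) :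
    subst g hg f = comp f g := by
  rw [algHom_apply, subst_X]

lemma comp_X (f : RatFunc ℂ) : comp f RatFunc.X = f :=
  (algHom_apply (AlgHom.id ℂ _) f).symm

lemma X_comp (f : RatFunc ℂ) : comp RatFunc.X f = f := by
  simp [comp]

lemma comp_assoc (f : RatFunc ℂ) {g h : RatFunc ℂ} (hg : ¬∃ c, g = RatFunc.C c)
    (hh : ¬∃ c, h = RatFunc.C c) : comp (comp f g) h = comp f (comp g h) := by
  have := algHom_apply ((subst h hh).comp (subst g hg)) f
  simpa [subst_apply, X_comp] using this

lemma comp_left_injective {f f' g : RatFunc ℂ} (hg : ¬∃ c, g = RatFunc.C c)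
    (h : comp f g = comp f' g) : f = f' := by
  rw [← subst_apply f g hg, ← subst_apply f' g hg] at h
  exact (subst g hg).injective h

lemma not_const_comp {f g : RatFunc ℂ} (hf : ¬∃ c, f = RatFunc.C c)
    (hg : ¬∃ c, g = RatFunc.C c) : ¬∃ c, comp f g = RatFunc.C c := by
  rintro ⟨c, hc⟩
  refine hf ⟨c, comp_left_injective hg ?_⟩
  rw [hc, comp, RatFunc.eval_C]

lemma not_const_of_comp {f g : RatFunc ℂ} (h : ¬∃ c, comp f g = RatFunc.C c) :
    ¬∃ c, f = RatFunc.C c := by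
  rintro ⟨c, rfl⟩
  exact h ⟨c, by simp [comp]⟩

lemma not_const_iff {f : RatFunc ℂ} : (¬∃ c, f = RatFunc.C c) ↔ 1 ≤ degree f := by
  rw [RatFunc.eq_C_iff, degree]
  omega

lemma not_const_X : ¬∃ c : ℂ, RatFunc.X = RatFunc.C c :=
  not_const_iff.mpr (by simp [degree])

lemma finrank_adjoin (f : RatFunc ℂ) : Module.finrank ℂ⟮f⟯ (RatFunc ℂ) = degree f :=
  f.finrank_eq_max_natDegree

lemma map_subst_adjoin (g : RatFunc ℂ) (hg : ¬∃ c, g = RatFunc.C c) (s : Set (RatFunc ℂ)) :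
    (adjoin ℂ s).map (subst g hg) = adjoin ℂ ((fun f => comp f g) '' s) := by
  rw [adjoin_map]
  congr 1
  exact Set.image_congr fun f _ => subst_apply f g hg

lemma map_subst_top (g : RatFunc ℂ) (hg : ¬∃ c, g = RatFunc.C c) :
    (⊤ : IntermediateField ℂ (RatFunc ℂ)).map (subst g hg) = ℂ⟮g⟯ := by
  rw [← RatFunc.adjoin_X, map_subst_adjoin, Set.image_singleton, X_comp]

lemma mem_adjoin_iff {f g : RatFunc ℂ} (hg : ¬∃ c, g = RatFunc.C c) :
    f ∈ ℂ⟮g⟯ ↔ ∃ h, f = comp h g := by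
  rw [← map_subst_top g hg, IntermediateField.mem_map]
  simp [subst_apply, eq_comm]

/-- Tower law for `ℂ(f ∘ g) ⊆ ℂ(g) ⊆ ℂ(z)`: substituting `g` carries `ℂ(f) ⊆ ℂ(z)` onto the lower
step. -/
lemma degree_comp (f : RatFunc ℂ) {g : RatFunc ℂ} (hg : ¬∃ c, g = RatFunc.C c) :
    degree (comp f g) = degree f * degree g := by
  have hle : ℂ⟮comp f g⟯ ≤ ℂ⟮g⟯ :=
    adjoin_simple_le_iff.mpr ((mem_adjoin_iff hg).mpr ⟨f, rfl⟩)
  rw [← finrank_adjoin, ← finrank_adjoin g, ← relfinrank_mul_finrank_top hle]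
  congr 1
  have : ℂ⟮comp f g⟯ = ℂ⟮f⟯.map (subst g hg) := by
    rw [map_subst_adjoin, Set.image_singleton]
  rw [this, ← map_subst_top g hg, relfinrank_map_map, relfinrank_top_right, finrank_adjoin]

lemma degree_eq_one_iff {f : RatFunc ℂ} : degree f = 1 ↔ ℂ⟮f⟯ = ⊤ := by
  rw [← finrank_adjoin, ← relfinrank_top_right, relfinrank_eq_one_iff, top_le_iff]

lemma not_const_of_isMobius {σ : RatFunc ℂ} (h : IsMobius σ) : ¬∃ c, σ = RatFunc.C c := by
  obtain ⟨a, b, c, d, hdet, rfl⟩ := h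
  rintro ⟨e, he⟩
  have coeffs : ∀ p q r s : ℂ, RatFunc.C p * RatFunc.X + RatFunc.C q =
      RatFunc.C r * RatFunc.X + RatFunc.C s → p = r ∧ q = s := by
    intro p q r s h
    have h' : (Polynomial.C p * Polynomial.X + Polynomial.C q : Polynomial ℂ) =
        Polynomial.C r * Polynomial.X + Polynomial.C s := by
      apply RatFunc.algebraMap_injective ℂ
      simpa using h
    exact ⟨by simpa using congrArg (fun P => P.coeff 1) h',
      by simpa using congrArg (fun P => P.coeff 0) h'⟩
  by_cases h0 : RatFunc.C c * RatFunc.X + RatFunc.C d = 0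
  · obtain ⟨rfl, rfl⟩ := coeffs c d 0 0 (by simpa using h0)
    simp at hdet
  · rw [div_eq_iff h0, mul_add, ← mul_assoc, ← map_mul, ← map_mul] at he
    obtain ⟨rfl, rfl⟩ := coeffs _ _ _ _ he
    exact hdet (by ring)

/-! ### Semiconjugacy of iterates -/

section Iterates

variable {A B X : RatFunc ℂ}

lemma not_const_iter (hA : ¬∃ c, A = RatFunc.C c) (k : ℕ) :
    ¬∃ c, iter A k = RatFunc.C c := by
  induction k with
  | zero => exact not_const_X
  | succ k ih => exact not_const_comp hA ih

lemma iter_comp_self (hA : ¬∃ c, A = RatFunc.C c) (k : ℕ) :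
    comp (iter A k) A = iter A (k + 1) := by
  induction k with
  | zero => simp [iter, X_comp, comp_X]
  | succ k ih =>
    rw [iter, comp_assoc _ (not_const_iter hA k) hA, ih]
    rfl

lemma iter_semiconj (hA : ¬∃ c, A = RatFunc.C c) (hB : ¬∃ c, B = RatFunc.C c)
    (hX : ¬∃ c, X = RatFunc.C c) (h : comp A X = comp X B) (k : ℕ) :
    comp (iter A k) X = comp X (iter B k) := by
  induction k with
  | zero => simp [iter, X_comp, comp_X]
  | succ k ih =>
    rw [iter, comp_assoc _ (not_const_iter hA k) hX, ih,
      ← comp_assoc _ hX (not_const_iter hB k), h, comp_assoc _ hB (not_const_iter hB k)]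
    rfl

/-- Substituting `B` into `ℂ(X, B^{∘k}) = ℂ(z)` gives `ℂ(X ∘ B, B^{∘(k+1)}) = ℂ(B)`, and `X ∘ B = A
∘ X` already lies in `ℂ(X)`. -/
lemma adjoin_iter_eq_top (hB : ¬∃ c, B = RatFunc.C c) (hX : ¬∃ c, X = RatFunc.C c)
    (h : comp A X = comp X B) (htop : adjoin ℂ {X, B} = ⊤) (k : ℕ) :
    adjoin ℂ {X, iter B (k + 1)} = ⊤ := by
  induction k with
  | zero => simpa [iter, comp_X] using htop
  | succ k ih =>
    have hXmem : X ∈ adjoin ℂ {X, iter B (k + 2)} := subset_adjoin _ _ (by simp)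
    have hBmem : B ∈ adjoin ℂ {comp X B, iter B (k + 2)} := by
      have := map_subst_adjoin B hB {X, iter B (k + 1)}
      rw [ih, map_subst_top, Set.image_pair, iter_comp_self hB] at this
      exact this ▸ mem_adjoin_simple_self ℂ B
    have hle : adjoin ℂ {comp X B, iter B (k + 2)} ≤ adjoin ℂ {X, iter B (k + 2)} := by
      rw [adjoin_le_iff, Set.insert_subset_iff, Set.singleton_subset_iff]
      refine ⟨?_, subset_adjoin _ _ (by simp)⟩
      exact adjoin_simple_le_iff.mpr hXmem ((mem_adjoin_iff hX).mpr ⟨A, h.symm⟩)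
    rw [eq_top_iff, ← htop, adjoin_le_iff, Set.insert_subset_iff, Set.singleton_subset_iff]
    exact ⟨hXmem, hle hBmem⟩

end Iterates

/-! ### The descent on the degree of `X` -/

/-- If `A ∘ X = X ∘ B`, the functions `X` and `B` generate `ℂ(z)`, and `X` is a left compositional
factor of `A`, then `X` has degree one: the equation `X(T) = A(X)` over `ℂ(X)` is satisfied both
by the generator `B` of `ℂ(z)`, so that it is irreducible, and by `W(X)`. -/
lemma degree_eq_one_of_adjoin_eq_top {A B X W : RatFunc ℂ} (hA : ¬∃ c, A = RatFunc.C c)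
    (hX : ¬∃ c, X = RatFunc.C c) (h : comp A X = comp X B) (hB : ¬∃ c, B = RatFunc.C c)
    (htop : adjoin ℂ {X, B} = ⊤) (hW : ¬∃ c, W = RatFunc.C c) (hAW : A = comp X W) :
    degree X = 1 := by
  let a : ℂ⟮X⟯ := ⟨comp A X, (mem_adjoin_iff hX).mpr ⟨A, rfl⟩⟩
  let w : ℂ⟮X⟯ := ⟨comp W X, (mem_adjoin_iff hX).mpr ⟨W, rfl⟩⟩
  let P : Polynomial ℂ⟮X⟯ := X.num.map (algebraMap ℂ ℂ⟮X⟯) -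
    Polynomial.C a * X.denom.map (algebraMap ℂ ℂ⟮X⟯)
  have aeval_P : ∀ Y : RatFunc ℂ, (¬∃ c, Y = RatFunc.C c) → comp X Y = comp A X →
      Polynomial.aeval Y P = 0 := by
    intro Y hY hYX
    have hden : X.denom.eval₂ RatFunc.C Y ≠ 0 := by
      have := (map_ne_zero (subst Y hY)).mpr (RatFunc.algebraMap_ne_zero X.denom_ne_zero)
      rw [subst_apply, comp, RatFunc.eval_algebraMap] at this
      simpa using this
    rw [comp, RatFunc.eval, div_eq_iff hden] at hYX
    have e1 : ∀ p : Polynomial ℂ, Polynomial.aeval Y p = p.eval₂ RatFunc.C Y := fun _ => rfl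
    simp only [P, map_sub, map_mul, Polynomial.aeval_map_algebraMap, Polynomial.aeval_C, e1]
    exact sub_eq_zero.mpr hYX
  -- Otherwise the coefficient at the degree of `X.denom` would make `A ∘ X` constant.
  have hP0 : P ≠ 0 := by
    intro hP
    have hc := congrArg (fun Q => ((Q.coeff X.denom.natDegree : ℂ⟮X⟯) : RatFunc ℂ)) hP
    apply not_const_comp hA hX
    refine ⟨X.num.coeff X.denom.natDegree / X.denom.leadingCoeff, ?_⟩
    rw [map_div₀, eq_div_iff ((map_ne_zero RatFunc.C).mpr
      (Polynomial.leadingCoeff_ne_zero.mpr X.denom_ne_zero)), eq_comm]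
    simpa [P, a, sub_eq_zero] using hc
  have hPdeg : P.natDegree ≤ degree X := by
    refine (Polynomial.natDegree_sub_le _ _).trans (max_le_max ?_ ?_)
    · exact Polynomial.natDegree_map_le
    · exact (Polynomial.natDegree_C_mul_le _ _).trans Polynomial.natDegree_map_le
  have hint : IsIntegral ℂ⟮X⟯ B :=
    isAlgebraic_iff_isIntegral.mp ⟨P, hP0, aeval_P B hB h.symm⟩
  have htop' : ℂ⟮X⟯⟮B⟯ = ⊤ := by
    rw [← restrictScalars_eq_top_iff (K := ℂ), adjoin_simple_adjoin_simple, ← htop]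
  have hmin : (minpoly ℂ⟮X⟯ B).natDegree = degree X := by
    rw [← adjoin.finrank hint, htop', finrank_top', finrank_adjoin]
  -- By degrees, `P` is a constant multiple of the minimal polynomial, so every root of `P` in
  -- `ℂ(X)` is a root of the latter.
  obtain ⟨Q, hQ⟩ := minpoly.dvd ℂ⟮X⟯ B (aeval_P B hB h.symm)
  have hQ0 : Q ≠ 0 := by
    rintro rfl
    exact hP0 (by simpa using hQ)
  have hQdeg : Q.natDegree = 0 := by
    have := congrArg Polynomial.natDegree hQ
    rw [Polynomial.natDegree_mul (minpoly.ne_zero hint) hQ0, hmin] at this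
    omega
  rw [Polynomial.eq_C_of_natDegree_eq_zero hQdeg] at hQ hQ0
  have hroot : (minpoly ℂ⟮X⟯ B).IsRoot w := by
    have hw : Polynomial.aeval (algebraMap ℂ⟮X⟯ (RatFunc ℂ) w) P = 0 := by
      refine aeval_P _ (not_const_comp hW hX) ?_
      rw [hAW, comp_assoc _ hW hX]
      rfl
    rw [Polynomial.aeval_algebraMap_eq_zero_iff, hQ, map_mul, Polynomial.aeval_C] at hw
    exact (mul_eq_zero.mp hw).resolve_right (by simpa using hQ0)
  have hBw := minpoly.root hint hroot
  rw [degree_eq_one_iff, eq_top_iff, ← htop, adjoin_le_iff, Set.insert_subset_iff,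
    Set.singleton_subset_iff]
  exact ⟨mem_adjoin_simple_self ℂ X, hBw ▸ w.2⟩

/-- With `V` the inverse of `X`, `B = V ∘ (A ∘ X)` and `A = (A ∘ X) ∘ V`. -/
lemma isElementaryTransformation_of_degree_eq_one {A B X : RatFunc ℂ}
    (hA : ¬∃ c, A = RatFunc.C c) (hB : ¬∃ c, B = RatFunc.C c) (hX : degree X = 1)
    (h : comp A X = comp X B) : IsElementaryTransformation B A := by
  have hXc : ¬∃ c, X = RatFunc.C c := not_const_iff.mpr hX.ge
  obtain ⟨V, hV⟩ := (mem_adjoin_iff (f := RatFunc.X) hXc).mp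
    (degree_eq_one_iff.mp hX ▸ mem_top)
  have hVc : ¬∃ c, V = RatFunc.C c := not_const_of_comp (hV ▸ not_const_X)
  have hXV : comp X V = RatFunc.X := by
    apply comp_left_injective hXc
    rw [comp_assoc _ hVc hXc, ← hV, comp_X, X_comp]
  refine ⟨V, comp A X, not_const_iff.mp hVc, not_const_iff.mp (not_const_comp hA hXc), ?_, ?_⟩
  · rw [h, ← comp_assoc _ hXc hB, ← hV, X_comp]
  · rw [comp_assoc _ hXc hVc, hXV, comp_X]

/-- If `X` and `B` do not generate `ℂ(z)`, they have a common right compositional factor of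
degree at least two. -/
lemma exists_common_right_factor {X B : RatFunc ℂ} (hX : ¬∃ c, X = RatFunc.C c)
    (htop : adjoin ℂ {X, B} ≠ ⊤) :
    ∃ W X' B', 2 ≤ degree W ∧ X = comp X' W ∧ B = comp B' W := by
  set E := adjoin ℂ {X, B} with hE
  have hXE : X ∈ E := subset_adjoin _ _ (by simp)
  have hBE : B ∈ E := subset_adjoin _ _ (by simp)
  have hbot : E ≠ ⊥ := by
    intro h0
    rw [h0, mem_bot] at hXE
    obtain ⟨c, hc⟩ := hXE
    exact hX ⟨c, hc.symm⟩
  have hW := RatFunc.Luroth.generator_ne_C hbot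
  have hgen := RatFunc.Luroth.eq_adjoin_generator (E := E)
  obtain ⟨X', hX'⟩ := (mem_adjoin_iff hW).mp (hgen ▸ hXE)
  obtain ⟨B', hB'⟩ := (mem_adjoin_iff hW).mp (hgen ▸ hBE)
  refine ⟨_, X', B', ?_, hX', hB'⟩
  have h1 := not_const_iff.mp hW
  have h2 : degree (RatFunc.Luroth.generator E) ≠ 1 := fun h =>
    htop (hgen.trans (degree_eq_one_iff.mp h))
  omega

/-- A function `B` semiconjugate to `A` by a left compositional factor `X` of an iterate of `A` is
equivalent to `A`. -/
theorem equivalent_of_semiconj {A : RatFunc ℂ} (hA : ¬∃ c, A = RatFunc.C c) (k : ℕ) :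
    ∀ (X B W : RatFunc ℂ), (¬∃ c, X = RatFunc.C c) → (¬∃ c, B = RatFunc.C c) →
      (¬∃ c, W = RatFunc.C c) → comp A X = comp X B → iter A (k + 1) = comp X W →
      Equivalent B A := by
  intro X
  induction hd : degree X using Nat.strong_induction_on generalizing X with
  | _ d ih =>
  intro B W hX hB hW h hAW
  by_cases htop : adjoin ℂ {X, B} = ⊤
  · have hdeg := degree_eq_one_of_adjoin_eq_top (not_const_iter hA (k + 1)) hX
      (iter_semiconj hA hB hX h (k + 1)) (not_const_iter hB (k + 1))
      (adjoin_iter_eq_top hB hX h htop k) hW hAW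
    exact .single (isElementaryTransformation_of_degree_eq_one hA hB hdeg h)
  · obtain ⟨V, X', B', hV, rfl, rfl⟩ := exists_common_right_factor hX htop
    have hVc : ¬∃ c, V = RatFunc.C c := not_const_iff.mpr (by omega)
    have hX' := not_const_of_comp hX
    have hB' := not_const_of_comp hB
    have hlt : degree X' < d := by
      rw [← hd, degree_comp _ hVc]
      have := not_const_iff.mp hX'
      nlinarith
    -- Pass from `B' ∘ V` to `V ∘ B'`, which `X'` semiconjugates to `A`; the cancelled `V` is
    -- absorbed into the cofactor `V ∘ W`.
    refine .head ⟨B', V, not_const_iff.mp hB', not_const_iff.mp hVc, rfl, rfl⟩ ?_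
    refine ih _ hlt X' rfl _ (comp V W) hX' (not_const_comp hVc hB') (not_const_comp hVc hW) ?_ ?_
    · apply comp_left_injective hVc
      rw [comp_assoc _ hX' hVc, h, comp_assoc _ hVc hB, comp_assoc _ (not_const_comp hVc hB') hVc,
        comp_assoc _ hB' hVc]
    · rw [hAW, comp_assoc _ hVc hW]

end RationalFunction

open RationalFunction in
theorem theorem5p2 (A : RatFunc ℂ) (hA : 2 ≤ RationalFunction.degree A)
    (σ : RatFunc ℂ) (hσ : σ ∈ RationalFunction.SigmaInfty A) :
    RationalFunction.Equivalent (RationalFunction.comp A σ) A := by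
  simp only [SigmaInfty, Set.mem_iUnion] at hσ
  obtain ⟨k, hk, hmob, hσ⟩ := hσ
  obtain ⟨k, rfl⟩ := Nat.exists_eq_add_of_le' hk
  have hAc : ¬∃ c, A = RatFunc.C c := not_const_iff.mpr (by omega)
  have hσc := not_const_of_isMobius hmob
  have hi := not_const_iter hAc (k + 1)
  refine equivalent_of_semiconj hAc k (iter A (k + 1)) _ RatFunc.X hi (not_const_comp hAc hσc)
    not_const_X ?_ (comp_X _).symm
  rw [← comp_assoc _ hAc hσc, iter_comp_self hAc, iter.eq_2 A (k + 1), comp_assoc _ hi hσc, hσ]
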